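/- Let $n\ge 1$ and $d\ge 2$. A pseudorange configuration $p=(x_1,\dots,x_n,\beta_1,\dots,\beta_n)\in\mathbb R^{n(d+1)}$ consists of positions $x_u\in\mathbb R^d$ and clock biases $\beta_u\in\mathbb R$ of $n$ agents; it is generic if its $nd$ spatial coordinates are not a root of any non-zero polynomial with integer coefficients. Let $\Gamma=(V,E)$, $V=\{1,\dots,n\}$, be a directed graph without loops or repeated arcs (opposite arcs $uv$, $vu$ may both be present). The pseudorange rigidity matrix is $$R_P(\Gamma,p)=D\,\frac{\partial F_P}{\partial p}=\bigl[\,R_D(\Gamma,p)\;\big|\;D\,B(\Gamma)^{\mathsf T}\,\bigr],$$ where $F_P$ has the entries $\|x_u-x_v\|+\beta_v-\beta_u$, $uv\in E$, $D$ is the diagonal matrix of the distances $\|x_u-x_v\|$, the row of $uv$ in $R_D$ is $x_u-x_v$ in the columns of $u$, $x_v-x_u$ in the columns of $v$ and $0$ elsewhere, and $B(\Gamma)$ is the signed incidence matrix (at points where $x_u=x_v$ for an arc $uv$, the row of $uv$ is $0$, as in the block form). Let $\tilde\Gamma$ be the underlying undirected multigraph of $\Gamma$, and $E_1$, $E_2$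 the sets of edges that appear once, respectively twice, in $\tilde\Gamma$. A decomposition $\tilde\Gamma=G_D\cup G_S$ is a pair of simple graphs $G_D=(V,E_D)$, $G_S=(V,E_S)$ with $E_D\cup E_S=E_1\cup E_2$ and $E_D\cap E_S=E_2$. For a simple graph $G$ on $V$ let $\operatorname{rank}R_D(G)$ be the rank of its distance rigidity matrix $R_D(G,x)$ at any generic $x\in\mathbb R^{nd}$ (it does not depend on the choice of $x$), and $\operatorname{rank}R_S(G)$ the rank of the signed incidence matrix of $G$ (for any orientation of its edges). If $p$ is generic, then $$\operatorname{rank}R_P(\Gamma,p)=\max_{\tilde\Gamma=G_D\cup G_S}\bigl(\operatorname{rank}R_D(G_D)+\operatorname{rank}R_S(G_S)\bigr),$$ the maximum being taken over all decompositions of $\tilde\Gamma$. Moreover, for every configuration $p$, generic or not, $\operatorname{rank}R_P(\Gamma,p)\le S_P(n,d)=S_D(n,d)+n-1$, where $S_D(n,d)=nd-\binom{d+1}{2}$ if $n\ge d+1$ and $S_D(n,d)=\binom n2$ if $n\le d$. -/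

import Mathlib

noncomputable section

namespace PseudorangeRigidity

open Matrix

/-! ### Configurations and genericity -/

/-- Spatial coordinates of `n` agents in `ℝ^d`: the entry `(u, i)` is the `i`-th coordinate of the
position of agent `u`. -/
abbrev Positions (n d : ℕ) : Type := Fin n × Fin d → ℝ

/-- Pseudorange configurations `p = (x₁, …, xₙ, β₁, …, βₙ) ∈ ℝ^{n(d+1)}`: the `nd` spatial
coordinates followed by the `n` clock biases. -/
abbrev Config (n d : ℕ) : Type := (Fin n × Fin d) ⊕ Fin n → ℝ

variable {n d : ℕ}

/-- The position of agent `u`, as a point of Euclidean space. -/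
def agentPos (x : Positions n d) (u : Fin n) : EuclideanSpace ℝ (Fin d) :=
  WithLp.toLp 2 fun i => x (u, i)

/-- The spatial part of a pseudorange configuration. -/
def Config.positions (p : Config n d) : Positions n d := fun j => p (Sum.inl j)

/-- The clock bias of agent `u`. -/
def Config.bias (p : Config n d) (u : Fin n) : ℝ := p (Sum.inr u)

/-- The spatial coordinates are not a root of any non-trivial polynomial with integer
coefficients. -/
def IsGenericPositions (x : Positions n d) : Prop :=
  ∀ P : MvPolynomial (Fin n × Fin d) ℤ, P ≠ 0 → MvPolynomial.aeval x P ≠ 0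

/-- A pseudorange configuration is generic if its spatial coordinates are; no condition is put on
the clock biases. -/
def Config.IsGeneric (p : Config n d) : Prop := IsGenericPositions p.positions

/-! ### Graphs -/

/-- The arcs of a directed graph. -/
abbrev Arc (Γ : Digraph (Fin n)) : Type := {a : Fin n × Fin n // Γ.Adj a.1 a.2}

open scoped Classical in
/-- The multiset of edges of the undirected multigraph underlying a directed graph: every arc `uv`
contributes one copy of the edge `{u, v}`. -/
def underlyingEdges (Γ : Digraph (Fin n)) : Multiset (Sym2 (Fin n)) :=
  (Finset.univ : Finset (Arc Γ)).val.map fun a => s(a.1.1, a.1.2)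

/-- The set of edges that appear exactly `k` times in a multiset of edges. -/
def edgesOfMult (E : Multiset (Sym2 (Fin n))) (k : ℕ) : Set (Sym2 (Fin n)) :=
  {e | E.count e = k}

/-- Two simple graphs `G_D = (V, E_D)` and `G_S = (V, E_S)` form a decomposition of the multigraph
with edge multiset `E` if `E_D ∪ E_S = E₁ ∪ E₂` and `E_D ∩ E_S = E₂`, where `E₁`, `E₂` are the sets
of edges that appear once, respectively twice, in `E`. -/
def IsDecomposition (E : Multiset (Sym2 (Fin n))) (G_D G_S : SimpleGraph (Fin n)) : Prop :=
  G_D.edgeSet ∪ G_S.edgeSet = edgesOfMult E 1 ∪ edgesOfMult E 2 ∧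
    G_D.edgeSet ∩ G_S.edgeSet = edgesOfMult E 2

/-! ### Rigidity matrices -/

/-- The pseudorange constraint `‖x_u - x_v‖ + β_v - β_u` of an arc `uv`. -/
def pseudorange (u v : Fin n) (p : Config n d) : ℝ :=
  ‖agentPos p.positions u - agentPos p.positions v‖ + p.bias v - p.bias u

/-- The Jacobian matrix of the pseudorange constraints, one row for each arc. -/
def jacobianP (Γ : Digraph (Fin n)) (p : Config n d) :
    Matrix (Arc Γ) ((Fin n × Fin d) ⊕ Fin n) ℝ :=
  Matrix.of fun a j => fderiv ℝ (pseudorange a.1.1 a.1.2) p (Pi.single j 1)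

/-- The diagonal matrix `D` of the distances `‖x_u - x_v‖`, `uv` an arc. -/
def distDiag (Γ : Digraph (Fin n)) (x : Positions n d) : Matrix (Arc Γ) (Arc Γ) ℝ :=
  Matrix.diagonal fun a => ‖agentPos x a.1.1 - agentPos x a.1.2‖

open scoped Classical in
/-- The pseudorange rigidity matrix `R_P = D · ∂F_P/∂p`. -/
def rigidityP (Γ : Digraph (Fin n)) (p : Config n d) :
    Matrix (Arc Γ) ((Fin n × Fin d) ⊕ Fin n) ℝ :=
  distDiag Γ p.positions * jacobianP Γ p

/-- The row of a distance rigidity matrix that belongs to the edge `{u, v}`: it is `x_u - x_v` in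
the columns of `u`, `x_v - x_u` in the columns of `v`, and zero elsewhere. -/
def distRow (x : Positions n d) (e : Sym2 (Fin n)) (j : Fin n × Fin d) : ℝ :=
  Sym2.lift ⟨fun u v => ((if j.1 = u then 1 else 0) - (if j.1 = v then 1 else 0)) *
    (x (u, j.2) - x (v, j.2)), fun u v => by ring⟩ e

/-- The distance rigidity matrix `R_D(Γ, x)` of a directed graph, viewed as an undirected
multigraph. -/
def rigidityDArc (Γ : Digraph (Fin n)) (x : Positions n d) : Matrix (Arc Γ) (Fin n × Fin d) ℝ :=
  Matrix.of fun a => distRow x s(a.1.1, a.1.2)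

/-- The distance rigidity matrix `R_D(G, x)` of a simple graph. -/
def rigidityD (G : SimpleGraph (Fin n)) (x : Positions n d) :
    Matrix G.edgeSet (Fin n × Fin d) ℝ :=
  Matrix.of fun e => distRow x e.1

/-- The incidence matrix `B(Γ)` of a directed graph: the column of the arc `uv` has the entry `-1`
at `u`, the entry `1` at `v`, and zeros elsewhere. -/
def incidenceArc (Γ : Digraph (Fin n)) : Matrix (Fin n) (Arc Γ) ℝ :=
  Matrix.of fun w a => (if w = a.1.2 then 1 else 0) - (if w = a.1.1 then 1 else 0)

/-- The (signed) incidence matrix `B(G)` of a simple graph on `{0, …, n-1}` whose edges are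
oriented from the smaller to the larger end. -/
def incidence (G : SimpleGraph (Fin n)) : Matrix (Fin n) G.edgeSet ℝ :=
  Matrix.of fun w e => (if w = e.1.sup then 1 else 0) - (if w = e.1.inf then 1 else 0)

/-- The generic rank of the distance rigidity matrix of `G` in `ℝ^d`: the rank that `R_D(G, x)` has
at the generic `x` (it is the same for all of them, see `rank_rigidityD_of_generic`). -/
def rankD (d : ℕ) (G : SimpleGraph (Fin n)) : ℕ :=
  sSup {r | ∃ x : Positions n d, IsGenericPositions x ∧ (rigidityD G x).rank = r}

open scoped Classical in
/-- The rank of the synchronization rigidity matrix of `G`, i.e. of the incidence matrix of `G`. -/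
def rankS (G : SimpleGraph (Fin n)) : ℕ := (incidence G).rank

/-- The maximal rank `S_D(n, d)` of a distance rigidity matrix of `n` agents in `ℝ^d`. -/
def boundD (n d : ℕ) : ℕ := if d + 1 ≤ n then n * d - (d + 1).choose 2 else n.choose 2

/-- `S_P(n, d) = S_D(n, d) + n - 1`. -/
def boundP (n d : ℕ) : ℕ := boundD n d + n - 1

/-! ### The generic distance rank is well defined, and the block form of `R_P` -/

/-- A matrix over a field has as many linearly independent rows as its rank. -/
theorem exists_independent_rows {K m k : Type*} [Field K] [Finite m] [Fintype k]
    (A : Matrix m k K) :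
    ∃ f : Fin A.rank → m, LinearIndependent K (A.submatrix f id).row := by
  rw [Matrix.rank_eq_finrank_span_row]
  obtain ⟨v, hv, -, hli⟩ := Submodule.exists_fun_fin_finrank_span_eq K (Set.range A.row)
  choose f hf using hv
  refine ⟨f, ?_⟩
  have : (A.submatrix f id).row = v := by
    funext i
    rw [← hf i]
    rfl
  rwa [this]

/-- A matrix over a field has a non-vanishing minor of order equal to its rank. -/
theorem exists_minor {K m k : Type*} [Field K] [Finite m] [Fintype k] (A : Matrix m k K) :
    ∃ (f : Fin A.rank → m) (g : Fin A.rank → k), (A.submatrix f g).det ≠ 0 := by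
  obtain ⟨f, hf⟩ := exists_independent_rows A
  have h1 : (A.submatrix f id)ᵀ.rank = A.rank := by
    rw [Matrix.rank_transpose, hf.rank_matrix, Fintype.card_fin]
  obtain ⟨g, hg⟩ := exists_independent_rows (A.submatrix f id)ᵀ
  refine ⟨f, g ∘ finCongr h1.symm, ?_⟩
  have h2 : LinearIndependent K (A.submatrix f (g ∘ finCongr h1.symm))ᵀ.row :=
    hg.comp _ (finCongr h1.symm).injective
  rw [← Matrix.det_transpose]
  exact ((Matrix.isUnit_iff_isUnit_det _).1
    (Matrix.linearIndependent_rows_iff_isUnit.1 h2)).ne_zero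

/-- A non-vanishing minor bounds the rank from below. -/
theorem le_rank_of_minor {K m k : Type*} [Field K] [Fintype k] (A : Matrix m k K)
    {r : ℕ} (f : Fin r → m) (g : Fin r → k) (h : (A.submatrix f g).det ≠ 0) : r ≤ A.rank := by
  have h1 : (A.submatrix f g).rank = r := by
    rw [Matrix.rank_of_det_ne_zero h, Fintype.card_fin]
  exact h1.symm.le.trans (Matrix.rank_submatrix_le A f g)

/-- The row of an edge in the distance rigidity matrix with indeterminate coordinates. -/
def distRowPoly (e : Sym2 (Fin n)) (j : Fin n × Fin d) : MvPolynomial (Fin n × Fin d) ℤ :=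
  Sym2.lift ⟨fun u v => ((if j.1 = u then 1 else 0) - (if j.1 = v then 1 else 0)) *
    (MvPolynomial.X (u, j.2) - MvPolynomial.X (v, j.2)), fun u v => by ring⟩ e

theorem aeval_distRowPoly (x : Positions n d) (e : Sym2 (Fin n)) (j : Fin n × Fin d) :
    MvPolynomial.aeval x (distRowPoly e j) = distRow x e j := by
  induction e with
  | _ u v => simp [distRowPoly, distRow, apply_ite (MvPolynomial.aeval x)]

theorem rank_rigidityD_le (G : SimpleGraph (Fin n)) (x y : Positions n d)
    (hy : IsGenericPositions y) : (rigidityD G x).rank ≤ (rigidityD G y).rank := by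
  obtain ⟨f, g, hfg⟩ := exists_minor (rigidityD G x)
  let M : Matrix (Fin (rigidityD G x).rank) (Fin (rigidityD G x).rank)
    (MvPolynomial (Fin n × Fin d) ℤ) := Matrix.of fun a b => distRowPoly (f a).1 (g b)
  have hM : ∀ z : Positions n d,
      MvPolynomial.aeval z M.det = ((rigidityD G z).submatrix f g).det := by
    intro z
    rw [AlgHom.map_det]
    congr 1
    ext a b
    exact aeval_distRowPoly z (f a).1 (g b)
  refine le_rank_of_minor _ f g ?_
  rw [← hM]
  refine hy _ fun h0 => hfg ?_
  rw [← hM, h0, map_zero]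

/-- `R_D(G, x)` has the same rank for all generic `x`. -/
theorem rank_rigidityD_of_generic (G : SimpleGraph (Fin n)) (x : Positions n d)
    (hx : IsGenericPositions x) : (rigidityD G x).rank = rankD d G := by
  have : {r | ∃ y : Positions n d, IsGenericPositions y ∧ (rigidityD G y).rank = r} =
      {(rigidityD G x).rank} := by
    ext r
    constructor
    · rintro ⟨y, hy, rfl⟩
      exact le_antisymm (rank_rigidityD_le G y x hx) (rank_rigidityD_le G x y hy)
    · rintro rfl
      exact ⟨x, hx, rfl⟩
  rw [rankD, this, csSup_singleton]

theorem norm_agentPos_sub (x : Positions n d) (u v : Fin n) :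
    ‖agentPos x u - agentPos x v‖ = Real.sqrt (∑ i, (x (u, i) - x (v, i)) ^ 2) := by
  simp [EuclideanSpace.norm_eq, agentPos]

theorem norm_mul_fderiv_pseudorange (u v : Fin n) (p : Config n d)
    (j : (Fin n × Fin d) ⊕ Fin n) :
    ‖agentPos p.positions u - agentPos p.positions v‖ *
        fderiv ℝ (pseudorange u v) p (Pi.single j 1) =
      Sum.elim (distRow p.positions s(u, v))
        (fun w => ‖agentPos p.positions u - agentPos p.positions v‖ *
          ((if w = v then 1 else 0) - (if w = u then 1 else 0))) j := by
  rcases eq_or_ne (‖agentPos p.positions u - agentPos p.positions v‖) 0 with h0 | h0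
  · have h1 : ∀ i, p.positions (u, i) = p.positions (v, i) := fun i => by
      have := congrArg (fun z : EuclideanSpace ℝ (Fin d) => z i) (sub_eq_zero.1 (norm_eq_zero.1 h0))
      simpa [agentPos] using this
    rcases j with j | j <;> simp [h0, distRow, h1]
  · let pr : (Fin n × Fin d) ⊕ Fin n → (Config n d →L[ℝ] ℝ) := fun k => ContinuousLinearMap.proj k
    have hpr : ∀ k, HasFDerivAt (fun q : Config n d => q k) (pr k) p := fun k =>
      (pr k).hasFDerivAt
    have hN : HasFDerivAt
        (fun q : Config n d => ∑ i, (q (Sum.inl (u, i)) - q (Sum.inl (v, i))) ^ 2)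
        (∑ i, (2 * (p (Sum.inl (u, i)) - p (Sum.inl (v, i)))) •
          (pr (Sum.inl (u, i)) - pr (Sum.inl (v, i)))) p := by
      refine HasFDerivAt.fun_sum fun i _ => ?_
      have := ((hpr (Sum.inl (u, i))).sub (hpr (Sum.inl (v, i)))).pow 2
      simpa using this
    have hs := norm_agentPos_sub p.positions u v
    have hne : (∑ i, (p (Sum.inl (u, i)) - p (Sum.inl (v, i))) ^ 2) ≠ 0 := fun h => h0 <| by
      rw [hs]
      exact (congrArg Real.sqrt h).trans Real.sqrt_zero
    have hF := ((hN.sqrt hne).fun_add (hpr (Sum.inr v))).fun_sub (hpr (Sum.inr u))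
    have hf : pseudorange u v = fun q : Config n d =>
        Real.sqrt (∑ i, (q (Sum.inl (u, i)) - q (Sum.inl (v, i))) ^ 2) + q (Sum.inr v)
          - q (Sum.inr u) := by
      funext q
      rw [pseudorange, norm_agentPos_sub]
      rfl
    have hs' : ‖agentPos p.positions u - agentPos p.positions v‖ =
      Real.sqrt (∑ i, (p (Sum.inl (u, i)) - p (Sum.inl (v, i))) ^ 2) := hs
    rw [hf, HasFDerivAt.fderiv hF, hs']
    rw [hs'] at h0
    rcases j with ⟨w, k⟩ | w
    · have hsum : (∑ i, (2 * (p (Sum.inl (u, i)) - p (Sum.inl (v, i)))) *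
          ((if u = w ∧ i = k then 1 else 0) - (if v = w ∧ i = k then 1 else 0)) : ℝ) =
          2 * distRow p.positions s(u, v) (w, k) := by
        rw [Finset.sum_eq_single k]
        · simp [distRow, Config.positions, eq_comm]
          ring
        · intro i _ hi
          simp [hi]
        · simp
      simp [pr, Pi.single_apply]
      rw [hsum]
      field_simp
    · simp [pr, Pi.single_apply, eq_comm]

open scoped Classical in
/-- The block form `R_P = [R_D | D Bᵀ]` of the pseudorange rigidity matrix. -/
theorem rigidityP_eq_fromCols (Γ : Digraph (Fin n)) (p : Config n d) :
    rigidityP Γ p = Matrix.fromCols (rigidityDArc Γ p.positions)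
      (distDiag Γ p.positions * (incidenceArc Γ)ᵀ) := by
  ext a j
  have h := norm_mul_fderiv_pseudorange a.1.1 a.1.2 p j
  rw [rigidityP, distDiag, Matrix.diagonal_mul]
  refine h.trans ?_
  rcases j with j | j
  · rfl
  · rw [Matrix.fromCols_apply_inr, Matrix.diagonal_mul]
    rfl

end PseudorangeRigidity

end

noncomputable section

namespace PseudorangeRigidity

open Matrix

/-! ### Square roots over a field -/

section Kummer

variable {E ι : Type*} [Field E]

/-! The row of an arc with edge `e` is `(distRow e, ±ℓ_e • incRow e)`, where `ℓ_e` is the length of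
`e`.

Upper bound (`exists_decomposition_rank_le`): a non-vanishing minor of maximal order is multilinear
in its rows. Splitting each row into its distance and bias parts leaves a non-zero summand, which
says which edges go to `G_D` and which to `G_S`.

Lower bound (`rankD_add_rankS_le_rank_rigidityP`): two opposite arcs have rows that differ only in
the sign of the bias part, so a double edge yields both parts separately. For single edges, replace
the factor `±ℓ_e` by 0 if `e` is in `G_D` and by 1 if it is in `G_S`. Independent rows of the two
matrices then form a block triangular, hence independent, system. The true factors are restored one
at a time (`det_add_mul_ne_zero`): a minor is affine in each factor, so its only possible zero lies
in the field generated by the coordinates and the other factors in use, and `±ℓ_e` does not.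

This last fact (`sqrt_sqDist_notMem`) is Kummer theory. If it failed, a product of squared lengths
of distinct edges would be a square in the field of rational functions of the coordinates. But as a
polynomial in one coordinate of an end of `e`, the squared length of `e` has a simple complex root
that no other factor shares; this needs `d ≥ 2`.

The bound for arbitrary `p` adds the ranks of the two blocks of `R_P`: constant biases are in the
kernel of one, rigid motions in that of the other. -/

theorem exists_add_mul_of_mem_closure_insert (L : Subfield E) {r : E} (hr : r ^ 2 ∈ L) {a : E}
    (ha : a ∈ Subfield.closure (insert r (L : Set E))) : ∃ s ∈ L, ∃ t ∈ L, a = s + t * r := by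
  by_cases hrL : r ∈ L
  · refine ⟨a, ?_, 0, L.zero_mem, by ring⟩
    have : Subfield.closure (insert r (L : Set E)) ≤ L :=
      Subfield.closure_le.2 (Set.insert_subset hrL subset_rfl)
    exact this ha
  induction ha using Subfield.closure_induction with
  | mem y hy =>
    rcases hy with rfl | hy
    · exact ⟨0, L.zero_mem, 1, L.one_mem, by ring⟩
    · exact ⟨y, hy, 0, L.zero_mem, by ring⟩
  | one => exact ⟨1, L.one_mem, 0, L.zero_mem, by ring⟩
  | add y z _ _ hy hz =>
    obtain ⟨s, hs, t, ht, rfl⟩ := hy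
    obtain ⟨s', hs', t', ht', rfl⟩ := hz
    exact ⟨s + s', L.add_mem hs hs', t + t', L.add_mem ht ht', by ring⟩
  | neg y _ hy =>
    obtain ⟨s, hs, t, ht, rfl⟩ := hy
    exact ⟨-s, L.neg_mem hs, -t, L.neg_mem ht, by ring⟩
  | mul y z _ _ hy hz =>
    obtain ⟨s, hs, t, ht, rfl⟩ := hy
    obtain ⟨s', hs', t', ht', rfl⟩ := hz
    exact ⟨s * s' + t * t' * r ^ 2, L.add_mem (L.mul_mem hs hs') (L.mul_mem (L.mul_mem ht ht') hr),
      s * t' + t * s', L.add_mem (L.mul_mem hs ht') (L.mul_mem ht hs'), by ring⟩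
  | inv y _ hy =>
    obtain ⟨s, hs, t, ht, rfl⟩ := hy
    by_cases ht0 : t = 0
    · exact ⟨s⁻¹, L.inv_mem hs, 0, L.zero_mem, by simp [ht0]⟩
    -- Since `r ∉ L`, neither `s + t r` nor its conjugate vanishes, so the inverse is the conjugate
    -- divided by the norm, which lies in `L`.
    have h1 : s + t * r ≠ 0 := fun h => hrL <| by
      have : r = -s / t := by
        rw [eq_div_iff ht0]
        linear_combination h
      rw [this]
      exact L.div_mem (L.neg_mem hs) ht
    have h2 : s - t * r ≠ 0 := fun h => hrL <| by
      have : r = s / t := by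
        rw [eq_div_iff ht0]
        linear_combination -h
      rw [this]
      exact L.div_mem hs ht
    have h3 : s ^ 2 - t ^ 2 * r ^ 2 = (s + t * r) * (s - t * r) := by ring
    have hN : s ^ 2 - t ^ 2 * r ^ 2 ∈ L :=
      L.sub_mem (L.pow_mem hs 2) (L.mul_mem (L.pow_mem ht 2) hr)
    refine ⟨s / (s ^ 2 - t ^ 2 * r ^ 2), L.div_mem hs hN, -t / (s ^ 2 - t ^ 2 * r ^ 2),
      L.div_mem (L.neg_mem ht) hN, ?_⟩
    rw [h3]
    field_simp
    ring

/-- A square root of an element of `K` that lies in the extension of `K` by further square roots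
becomes an element of `K` after multiplication by some of these. -/
theorem exists_mul_prod_mem_of_mem_closure [NeZero (2 : E)] (K : Subfield E) (r : ι → E)
    (hr : ∀ i, r i ^ 2 ∈ K) (F : Finset ι) {a : E} (ha2 : a ^ 2 ∈ K)
    (ha : a ∈ Subfield.closure ((K : Set E) ∪ r '' F)) :
    ∃ T ⊆ F, a * ∏ i ∈ T, r i ∈ K := by
  classical
  induction F using Finset.induction_on generalizing a with
  | empty => exact ⟨∅, subset_rfl, by simpa using ha⟩
  | insert m F hm ih =>
    set L := Subfield.closure ((K : Set E) ∪ r '' F)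
    have hKL : K ≤ L := fun y hy => Subfield.subset_closure (Or.inl hy)
    have hle : Subfield.closure ((K : Set E) ∪ r '' (insert m F : Finset ι)) ≤
        Subfield.closure (insert (r m) (L : Set E)) := by
      refine Subfield.closure_le.2 ?_
      rintro y (hy | ⟨i, hi, rfl⟩)
      · exact Subfield.subset_closure (Or.inr (hKL hy))
      · rcases Finset.mem_insert.1 (Finset.mem_coe.1 hi) with rfl | hi
        · exact Subfield.subset_closure (Or.inl rfl)
        · exact Subfield.subset_closure (Or.inr (Subfield.subset_closure (Or.inr ⟨i, hi, rfl⟩)))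
    obtain ⟨s, hs, t, ht, hst⟩ := exists_add_mul_of_mem_closure_insert L (hKL (hr m)) (hle ha)
    have hold : a ∈ L → ∃ T ⊆ insert m F, a * ∏ i ∈ T, r i ∈ K := fun h => by
      obtain ⟨T, hT, h⟩ := ih ha2 h
      exact ⟨T, hT.trans (Finset.subset_insert _ _), h⟩
    -- In `a = s + t * r m`, if both coefficients are non-zero, then `a ^ 2 = s ^ 2 + 2 s t r m + t
    -- ^ 2 (r m) ^ 2` puts `r m` into `L`. So either `a ∈ L` or `a` is an `L`-multiple of `r m`; in
    -- the latter case `m` joins `T`.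
    by_cases hs0 : s = 0
    · have hmem : a * r m ∈ L := by
        have : a * r m = t * r m ^ 2 := by rw [hst, hs0]; ring
        rw [this]
        exact L.mul_mem ht (hKL (hr m))
      obtain ⟨T, hT, h⟩ := ih (a := a * r m) (by rw [mul_pow]; exact K.mul_mem ha2 (hr m)) hmem
      refine ⟨insert m T, Finset.insert_subset_insert _ hT, ?_⟩
      rwa [Finset.prod_insert (fun h => hm (hT h)), ← mul_assoc]
    · refine hold ?_
      by_cases ht0 : t = 0
      · rw [hst, ht0]
        simpa using hs
      have h2 : (2 : E) ≠ 0 := NeZero.ne _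
      have hrm : r m = (a ^ 2 - s ^ 2 - t ^ 2 * r m ^ 2) / (2 * s * t) := by
        rw [eq_div_iff (mul_ne_zero (mul_ne_zero h2 hs0) ht0)]
        rw [hst]; ring
      have : r m ∈ L := by
        rw [hrm]
        exact L.div_mem (L.sub_mem (L.sub_mem (hKL ha2) (L.pow_mem hs 2))
          (L.mul_mem (L.pow_mem ht 2) (hKL (hr m))))
          (L.mul_mem (L.mul_mem (by exact_mod_cast natCast_mem L 2) hs) ht)
      rw [hst]
      exact L.add_mem hs (L.mul_mem ht this)

end Kummer

/-! ### Determinants with affine parameters in their rows -/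

section Det

variable {E ι : Type*} [Field E] [Fintype ι] [DecidableEq ι]

theorem det_mem_of_forall_mem (L : Subfield E) (M : Matrix ι ι E) (h : ∀ i j, M i j ∈ L) :
    M.det ∈ L := by
  have : M = L.subtype.mapMatrix (Matrix.of fun i j => (⟨M i j, h i j⟩ : L)) := by
    ext i j
    rfl
  rw [this, ← RingHom.map_det]
  exact SetLike.coe_mem _

/-- A determinant whose rows depend affinely on parameters remains non-zero when parameters are
successively replaced by elements outside of the field generated so far. -/
theorem det_add_mul_ne_zero (K : Subfield E) (w z : Matrix ι ι E) (s t : ι → E)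
    (hw : ∀ i j, w i j ∈ K) (hz : ∀ i j, z i j ∈ K) (hs : ∀ i, s i ∈ K)
    (ht : ∀ (J : Finset ι) (i : ι), i ∉ J →
      t i = s i ∨ t i ∉ Subfield.closure ((K : Set E) ∪ t '' J))
    (h0 : (Matrix.of fun i j => w i j + s i * z i j).det ≠ 0) :
    (Matrix.of fun i j => w i j + t i * z i j).det ≠ 0 := by
  suffices h : ∀ J : Finset ι,
      (Matrix.of fun i j => w i j + (if i ∈ J then t i else s i) * z i j).det ≠ 0 by
    simpa using h Finset.univ
  intro J
  induction J using Finset.induction_on with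
  | empty => simpa using h0
  | insert m J hm ih =>
    set L := Subfield.closure ((K : Set E) ∪ t '' J)
    have hKL : K ≤ L := fun y hy => Subfield.subset_closure (Or.inl hy)
    set M : Matrix ι ι E := Matrix.of fun i j => w i j + (if i ∈ J then t i else s i) * z i j
      with hMdef
    have hM : ∀ i j, M i j ∈ L := fun i j => by
      refine L.add_mem (hKL (hw i j)) (L.mul_mem ?_ (hKL (hz i j)))
      split_ifs with h
      · exact Subfield.subset_closure (Or.inr ⟨i, h, rfl⟩)
      · exact hKL (hs i)
    have hup : ∀ v : ι → E, (∀ j, v j ∈ L) → (M.updateRow m v).det ∈ L := fun v hv => by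
      refine det_mem_of_forall_mem L _ fun i j => ?_
      rw [Matrix.updateRow_apply]
      split_ifs
      exacts [hv j, hM i j]
    have hold : M = M.updateRow m (w m + s m • z m) := by
      ext i j
      rw [Matrix.updateRow_apply]
      split_ifs with h
      · subst h; simp [hMdef, hm]
      · rfl
    have hnew : (Matrix.of fun i j => w i j + (if i ∈ insert m J then t i else s i) * z i j) =
        M.updateRow m (w m + t m • z m) := by
      ext i j
      rw [Matrix.updateRow_apply]
      split_ifs with h
      · subst h; simp
      · simp [hMdef, h]
    rw [hnew]
    rcases ht J m hm with h | h
    · rwa [h, ← hold]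
    rw [hold] at ih
    rw [Matrix.det_updateRow_add, Matrix.det_updateRow_smul] at ih ⊢
    have hg := hup (w m) fun j => hKL (hw m j)
    have hh := hup (z m) fun j => hKL (hz m j)
    intro h1
    -- As a function of the `m`-th parameter the determinant is affine over `L` and non-zero at `s
    -- m`. It is either a non-zero constant or has a single root, which lies in `L`.
    by_cases hz0 : (M.updateRow m (z m)).det = 0
    · rw [hz0] at ih h1
      exact ih (by simpa using h1)
    · refine h ?_
      have : t m = -(M.updateRow m (w m)).det / (M.updateRow m (z m)).det := by
        rw [eq_div_iff hz0]
        linear_combination h1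
      rw [this]
      exact L.div_mem (L.neg_mem hg) hh

end Det

variable {n d : ℕ}

/-! ### Squared distances -/

/-- The squared length of an edge, for coordinates in any commutative ring. -/
def sqDist {R : Type*} [CommRing R] (x : Fin n × Fin d → R) (e : Sym2 (Fin n)) : R :=
  Sym2.lift ⟨fun u v => ∑ i, (x (u, i) - x (v, i)) ^ 2,
    fun u v => Finset.sum_congr rfl fun i _ => by ring⟩ e

theorem sqDist_mk {R : Type*} [CommRing R] (x : Fin n × Fin d → R) (u v : Fin n) :
    sqDist x s(u, v) = ∑ i, (x (u, i) - x (v, i)) ^ 2 := rfl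

theorem map_sqDist {R S : Type*} [CommRing R] [CommRing S] (f : R →+* S) (x : Fin n × Fin d → R)
    (e : Sym2 (Fin n)) : f (sqDist x e) = sqDist (fun j => f (x j)) e := by
  induction e with
  | _ u v => simp [sqDist_mk]

theorem IsGenericPositions.injective {x : Positions n d} (hx : IsGenericPositions x) :
    Function.Injective x := by
  intro j k hjk
  by_contra hne
  refine hx (MvPolynomial.X j - MvPolynomial.X k) (sub_ne_zero.2 fun h => hne ?_) (by simp [hjk])
  exact MvPolynomial.X_injective h

theorem IsGenericPositions.aeval_injective {x : Positions n d} (hx : IsGenericPositions x) :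
    Function.Injective (MvPolynomial.aeval (R := ℤ) x) := by
  rw [injective_iff_map_eq_zero]
  intro P hP
  by_contra h
  exact hx P h hP

theorem sqDist_pos {x : Positions n d} (hx : IsGenericPositions x) (hd : 0 < d)
    {e : Sym2 (Fin n)} (he : ¬ e.IsDiag) : 0 < sqDist x e := by
  induction e with
  | _ u v =>
    rw [sqDist_mk]
    refine Finset.sum_pos (fun i _ => ?_) ⟨⟨0, hd⟩, Finset.mem_univ _⟩
    have : x (u, i) - x (v, i) ≠ 0 := sub_ne_zero.2 fun h => he (by
      simpa using congrArg Prod.fst (hx.injective h))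
    positivity

/-- The specialization of one spatial coordinate `(u, i)` to a complex number, all others being
kept. -/
def specialize (x : Positions n d) (u : Fin n) (i : Fin d) (z : ℂ) : Fin n × Fin d → ℂ :=
  Function.update (fun j => (x j : ℂ)) (u, i) z

theorem specialize_of_ne (x : Positions n d) {u w : Fin n} (i k : Fin d) (z : ℂ) (h : w ≠ u) :
    specialize x u i z (w, k) = x (w, k) :=
  Function.update_of_ne (fun h' => h (congrArg Prod.fst h')) _ _

theorem sqDist_specialize_of_notMem (x : Positions n d) {u : Fin n} (i : Fin d) (z : ℂ)
    {e : Sym2 (Fin n)} (he : u ∉ e) : sqDist (specialize x u i z) e = sqDist x e := by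
  induction e with
  | _ a b =>
    simp only [Sym2.mem_iff, not_or] at he
    simp [sqDist_mk, specialize_of_ne x i _ z (Ne.symm he.1),
      specialize_of_ne x i _ z (Ne.symm he.2)]

theorem sqDist_specialize (x : Positions n d) {u v : Fin n} (i : Fin d) (z : ℂ) (huv : v ≠ u) :
    sqDist (specialize x u i z) s(u, v) = (z - x (v, i)) ^ 2 +
      ((∑ k ∈ Finset.univ.erase i, (x (u, k) - x (v, k)) ^ 2 : ℝ) : ℂ) := by
  rw [sqDist_mk, ← Finset.add_sum_erase _ _ (Finset.mem_univ i), specialize_of_ne x i i z huv]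
  congr 1
  · simp [specialize]
  · rw [Complex.ofReal_sum]
    refine Finset.sum_congr rfl fun k hk => ?_
    rw [specialize_of_ne x i k z huv, specialize, Function.update_of_ne]
    · simp
    · intro h
      exact Finset.ne_of_mem_erase hk (congrArg Prod.snd h)

open Polynomial in
/-- The specialization of a polynomial in all spatial coordinates to a univariate one, where only
the coordinate `(u, i)` remains variable. -/
def toUnivariate (x : Positions n d) (u : Fin n) (i : Fin d) :
    MvPolynomial (Fin n × Fin d) ℤ →+* ℂ[X] :=
  (MvPolynomial.aeval (Function.update (fun j => C (x j : ℂ)) (u, i) X)).toRingHom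

open Polynomial in
theorem eval_toUnivariate (x : Positions n d) (u : Fin n) (i : Fin d) (z : ℂ)
    (P : MvPolynomial (Fin n × Fin d) ℤ) :
    (toUnivariate x u i P).eval z = MvPolynomial.aeval (specialize x u i z) P := by
  have : (evalRingHom z).comp (toUnivariate x u i) =
      (MvPolynomial.aeval (R := ℤ) (specialize x u i z)).toRingHom := by
    refine MvPolynomial.ringHom_ext (fun r => by simp) fun j => ?_
    by_cases h : j = (u, i)
    · subst h; simp [toUnivariate, specialize]
    · simp [toUnivariate, specialize, h]
  exact RingHom.congr_fun this P

/-- Evaluating the univariate polynomial at the original coordinate `x (u, i)` gives back `P` at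
`x`, which is non-zero by genericity. -/
theorem toUnivariate_ne_zero {x : Positions n d} (hx : IsGenericPositions x) (u : Fin n)
    (i : Fin d) {P : MvPolynomial (Fin n × Fin d) ℤ} (hP : P ≠ 0) : toUnivariate x u i P ≠ 0 := by
  intro h
  have h1 := eval_toUnivariate x u i (x (u, i)) P
  have h2 : specialize x u i (x (u, i)) = algebraMap ℝ ℂ ∘ x := by
    funext j
    simp [specialize]
  rw [h, Polynomial.eval_zero, h2, MvPolynomial.aeval_algebraMap_apply] at h1
  exact hx P hP ((map_eq_zero (algebraMap ℝ ℂ)).1 h1.symm)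

theorem eval_toUnivariate_sqDist (x : Positions n d) (u : Fin n) (i : Fin d) (z : ℂ)
    (e : Sym2 (Fin n)) :
    (toUnivariate x u i (sqDist MvPolynomial.X e)).eval z = sqDist (specialize x u i z) e := by
  rw [eval_toUnivariate]
  refine (map_sqDist (MvPolynomial.aeval (R := ℤ) (specialize x u i z)).toRingHom _ e).trans ?_
  simp

/-- The product of the squared lengths of distinct edges is not a square in the field of rational
functions of the spatial coordinates. -/
theorem sq_mul_prod_sqDist_ne_sq {x : Positions n d} (hx : IsGenericPositions x) (hd : 2 ≤ d)
    {e : Sym2 (Fin n)} (he : ¬ e.IsDiag) (T : Finset (Sym2 (Fin n))) (heT : e ∉ T)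
    (hT : ∀ f ∈ T, ¬ f.IsDiag) {A B : MvPolynomial (Fin n × Fin d) ℤ} (hB : B ≠ 0) :
    B ^ 2 * (sqDist MvPolynomial.X e * ∏ f ∈ T, sqDist MvPolynomial.X f) ≠ A ^ 2 := by
  intro hAB
  induction e with
  | _ u v =>
    have huv : v ≠ u := fun h => he (by simp [h])
    -- Coordinate `i` of `u` becomes the variable; the second coordinate `i'` makes the remaining
    -- part `c` of the squared length positive. Hence the roots `z`, `z'` are not real.
    let i : Fin d := ⟨0, by lia⟩
    let i' : Fin d := ⟨1, by lia⟩
    set c : ℝ := ∑ k ∈ Finset.univ.erase i, (x (u, k) - x (v, k)) ^ 2 with hc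
    have hcpos : 0 < c := by
      refine Finset.sum_pos (fun k _ => ?_) ⟨i', by simp [i, i']⟩
      have : x (u, k) - x (v, k) ≠ 0 := sub_ne_zero.2 fun h => huv
        (congrArg Prod.fst (hx.injective h)).symm
      positivity
    set z : ℂ := x (v, i) + Real.sqrt c * Complex.I with hz
    set z' : ℂ := x (v, i) - Real.sqrt c * Complex.I with hz'
    have hsc : Real.sqrt c ≠ 0 := (Real.sqrt_pos.2 hcpos).ne'
    have hzz' : z ≠ z' := fun h => hsc <| by
      have := congrArg Complex.im h
      simp [hz, hz'] at this
      linarith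
    have hsq : ((Real.sqrt c : ℝ) : ℂ) ^ 2 = c := by
      rw [← Complex.ofReal_pow, Real.sq_sqrt hcpos.le]
    have hfac : toUnivariate x u i (sqDist MvPolynomial.X s(u, v)) =
        (Polynomial.X - Polynomial.C z) * (Polynomial.X - Polynomial.C z') := by
      refine Polynomial.funext fun y => ?_
      rw [eval_toUnivariate_sqDist, sqDist_specialize x i y huv, ← hc, ← hsq]
      simp only [Polynomial.eval_mul, Polynomial.eval_sub, Polynomial.eval_X, Polynomial.eval_C]
      rw [hz, hz']
      linear_combination ((Real.sqrt c : ℂ) ^ 2) * Complex.I_sq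
    -- For another edge `uw`, the value at `z` has imaginary part `2 (x (v, i) - x (w, i)) √c`,
    -- non-zero by genericity. An edge avoiding `u` keeps its positive squared length.
    have hprod : (toUnivariate x u i (∏ f ∈ T, sqDist MvPolynomial.X f)).eval z ≠ 0 := by
      rw [map_prod, Polynomial.eval_prod, Finset.prod_ne_zero_iff]
      intro f hf
      rw [eval_toUnivariate_sqDist]
      by_cases huf : u ∈ f
      · obtain ⟨w, rfl⟩ := huf
        have hwu : w ≠ u := fun h => hT _ hf (by simp [h])
        have hwv : v ≠ w := fun h => heT (h ▸ hf)
        rw [sqDist_specialize x i z hwu]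
        intro h0
        have him := congrArg Complex.im h0
        simp [hz, pow_two] at him
        have h1 : x (v, i) - x (w, i) = 0 := by
          rcases mul_eq_zero.1 (show (x (v, i) - x (w, i)) * Real.sqrt c = 0 by linarith) with h | h
          · exact h
          · exact absurd h hsc
        exact hwv (congrArg Prod.fst (hx.injective (sub_eq_zero.1 h1)))
      · rw [sqDist_specialize_of_notMem x i z huf]
        exact_mod_cast (sqDist_pos hx (by lia) (hT f hf)).ne'
    have hB' := toUnivariate_ne_zero hx u i hB
    have hAB' := congrArg (toUnivariate x u i) hAB
    rw [map_mul, map_mul, map_pow, map_pow, hfac] at hAB'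
    set b := toUnivariate x u i B
    set a := toUnivariate x u i A
    set g := toUnivariate x u i (∏ f ∈ T, sqDist MvPolynomial.X f)
    have hg : g ≠ 0 := fun h => hprod (by simp [h])
    have h1 : b ^ 2 * ((Polynomial.X - Polynomial.C z) * (Polynomial.X - Polynomial.C z') * g) ≠
        0 :=
      mul_ne_zero (pow_ne_zero 2 hB') (mul_ne_zero (mul_ne_zero (Polynomial.X_sub_C_ne_zero _)
        (Polynomial.X_sub_C_ne_zero _)) hg)
    -- The multiplicity of `z` is odd on the left and even on the right.
    have hroots := congrArg (fun P : Polynomial ℂ => P.roots.count z) hAB'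
    have h2 := right_ne_zero_of_mul h1
    rw [Polynomial.roots_mul h1, Polynomial.roots_mul h2,
      Polynomial.roots_mul (left_ne_zero_of_mul h2), Polynomial.roots_pow, Polynomial.roots_pow,
      Polynomial.roots_X_sub_C, Polynomial.roots_X_sub_C] at hroots
    have hg0 : g.roots.count z = 0 := by
      rw [Polynomial.count_roots]
      exact Polynomial.rootMultiplicity_eq_zero hprod
    simp [hg0, hzz'] at hroots
    lia

/-- A square root of the squared length of an edge does not lie in the field generated by generic
spatial coordinates and by the square roots of the squared lengths of other edges. -/
theorem sqrt_sqDist_notMem {x : Positions n d} (hx : IsGenericPositions x) (hd : 2 ≤ d)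
    {e : Sym2 (Fin n)} (he : ¬ e.IsDiag) (F : Finset (Sym2 (Fin n))) (heF : e ∉ F)
    (hF : ∀ f ∈ F, ¬ f.IsDiag) :
    Real.sqrt (sqDist x e) ∉ Subfield.closure ((Subfield.closure (Set.range x) : Set ℝ) ∪
      (fun f => Real.sqrt (sqDist x f)) '' F) := by
  intro hmem
  set K := Subfield.closure (Set.range x)
  have hnn : ∀ f, 0 ≤ sqDist x f := fun f => by
    induction f with
    | _ u v => rw [sqDist_mk]; exact Finset.sum_nonneg fun i _ => sq_nonneg _
  have hK : ∀ f, sqDist x f ∈ K := fun f => by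
    induction f with
    | _ u v => rw [sqDist_mk]; exact K.sum_mem fun i _ => K.pow_mem (K.sub_mem
        (Subfield.subset_closure ⟨_, rfl⟩) (Subfield.subset_closure ⟨_, rfl⟩)) 2
  have hsq : ∀ f, Real.sqrt (sqDist x f) ^ 2 = sqDist x f := fun f => Real.sq_sqrt (hnn f)
  obtain ⟨T, hTF, hT⟩ := exists_mul_prod_mem_of_mem_closure K (fun f => Real.sqrt (sqDist x f))
    (fun f => by rw [hsq]; exact hK f) F (by rw [hsq]; exact hK e) hmem
  -- Elements of `K` are quotients `A(x) / B(x)` of integer polynomials; genericity lifts the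
  -- squared relation from values at `x` to the polynomials themselves.
  obtain ⟨a, ha, b, hb, hab⟩ := Subfield.mem_closure_iff.1 hT
  have hring : ∀ y ∈ Subring.closure (Set.range x), ∃ P : MvPolynomial (Fin n × Fin d) ℤ,
      MvPolynomial.aeval x P = y := fun y hy => by
    have : Subring.closure (Set.range x) ≤
        (MvPolynomial.aeval (R := ℤ) x).toRingHom.range := by
      refine Subring.closure_le.2 ?_
      rintro _ ⟨j, rfl⟩
      exact ⟨MvPolynomial.X j, by simp⟩
    exact this hy
  obtain ⟨A, rfl⟩ := hring a ha
  obtain ⟨B, rfl⟩ := hring b hb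
  have hne : Real.sqrt (sqDist x e) * ∏ f ∈ T, Real.sqrt (sqDist x f) ≠ 0 :=
    mul_ne_zero (Real.sqrt_pos.2 (sqDist_pos hx (by lia) he)).ne' (Finset.prod_ne_zero_iff.2
      fun f hf => (Real.sqrt_pos.2 (sqDist_pos hx (by lia) (hF f (hTF hf)))).ne')
  rw [← hab] at hne
  have hBx : MvPolynomial.aeval x B ≠ 0 := fun h => hne (by simp [h])
  have hB : B ≠ 0 := fun h => hBx (by simp [h])
  refine sq_mul_prod_sqDist_ne_sq hx hd he T (fun h => heF (hTF h)) (fun f hf => hF f (hTF hf)) hB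
    (A := A) (hx.aeval_injective ?_)
  have hX : ∀ f, MvPolynomial.aeval x (sqDist MvPolynomial.X f : MvPolynomial _ ℤ) =
      sqDist x f := fun f => by
    refine (map_sqDist (MvPolynomial.aeval (R := ℤ) x).toRingHom _ f).trans ?_
    simp
  rw [map_mul, map_mul, map_pow, map_pow, map_prod, hX]
  simp only [hX]
  rw [div_eq_iff hBx] at hab
  rw [hab, mul_pow, mul_pow, hsq, ← Finset.prod_pow]
  simp only [hsq]
  ring

/-! ### Linear independence of rows -/

theorem exists_det_ne_zero_of_linearIndependent {E ι κ : Type*} [Field E] [Fintype ι]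
    [DecidableEq ι] [Fintype κ] (v : ι → κ → E) (hv : LinearIndependent E v) :
    ∃ g : ι → κ, (Matrix.of fun i j => v i (g j)).det ≠ 0 := by
  have h1 : (Matrix.of v)ᵀ.rank = Fintype.card ι := by
    rw [Matrix.rank_transpose]
    exact LinearIndependent.rank_matrix (M := Matrix.of v) hv
  obtain ⟨g, hg⟩ := exists_independent_rows (Matrix.of v)ᵀ
  let φ : ι ≃ Fin (Matrix.of v)ᵀ.rank := Fintype.equivFinOfCardEq h1.symm
  refine ⟨g ∘ φ, ?_⟩
  have h2 : LinearIndependent E ((Matrix.of v).submatrix id (g ∘ φ))ᵀ.row :=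
    hg.comp _ φ.injective
  rw [← Matrix.det_transpose]
  exact ((Matrix.isUnit_iff_isUnit_det _).1
    (Matrix.linearIndependent_rows_iff_isUnit.1 h2)).ne_zero

theorem linearIndependent_of_det_ne_zero {E ι κ : Type*} [Field E] [Fintype ι]
    [DecidableEq ι] (v : ι → κ → E) (g : ι → κ)
    (h : (Matrix.of fun i j => v i (g j)).det ≠ 0) : LinearIndependent E v := by
  have h1 : LinearIndependent E (Matrix.of fun i j => v i (g j)).row :=
    Matrix.linearIndependent_rows_iff_isUnit.2
      ((Matrix.isUnit_iff_isUnit_det _).2 (isUnit_iff_ne_zero.2 h))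
  exact LinearIndependent.of_comp (LinearMap.funLeft E E g) h1

/-- Columns with a non-vanishing minor for the parameters `s` still give one for `t`, by
`det_add_mul_ne_zero`. -/
theorem linearIndependent_add_smul {E ι κ : Type*} [Field E] [Fintype ι] [Fintype κ]
    (K : Subfield E) (w z : ι → κ → E) (s t : ι → E)
    (hw : ∀ i j, w i j ∈ K) (hz : ∀ i j, z i j ∈ K) (hs : ∀ i, s i ∈ K)
    (ht : ∀ (J : Finset ι) (i : ι), i ∉ J →
      t i = s i ∨ t i ∉ Subfield.closure ((K : Set E) ∪ t '' J))
    (h0 : LinearIndependent E fun i => w i + s i • z i) :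
    LinearIndependent E fun i => w i + t i • z i := by
  classical
  obtain ⟨g, hg⟩ := exists_det_ne_zero_of_linearIndependent _ h0
  exact linearIndependent_of_det_ne_zero _ g
    (det_add_mul_ne_zero K (fun i j => w i (g j)) (fun i j => z i (g j)) s t
      (fun i j => hw i (g j)) (fun i j => hz i (g j)) hs ht hg)

theorem linearIndependent_block {E ι κ α β : Type*} [Field E] [Fintype ι] [Fintype κ]
    (a : ι → α → E) (b : κ → β → E) (c : κ → α → E)
    (ha : LinearIndependent E a) (hb : LinearIndependent E b) :
    LinearIndependent E (Sum.elim (fun i => Sum.elim (a i) (0 : β → E))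
      (fun k => Sum.elim (c k) (b k)) : ι ⊕ κ → α ⊕ β → E) := by
  rw [Fintype.linearIndependent_iff] at ha hb ⊢
  intro g hg
  have h2 : ∀ k, g (Sum.inr k) = 0 := hb _ <| by
    funext j
    simpa [Finset.sum_apply] using congrFun hg (Sum.inr j)
  have h1 : ∀ i, g (Sum.inl i) = 0 := ha _ <| by
    funext j
    simpa [Finset.sum_apply, h2] using congrFun hg (Sum.inl j)
  rintro (i | k)
  exacts [h1 i, h2 k]

theorem card_le_rank_of_mem_span {E ι m k : Type*} [Field E] [Fintype ι] [Finite m] [Fintype k]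
    (M : Matrix m k E) {v : ι → k → E} (hv : LinearIndependent E v)
    (h : ∀ i, v i ∈ Submodule.span E (Set.range M.row)) : Fintype.card ι ≤ M.rank := by
  rw [Matrix.rank_eq_finrank_span_row]
  have hv' : LinearIndependent E fun i => (⟨v i, h i⟩ : Submodule.span E (Set.range M.row)) :=
    LinearIndependent.of_comp (Submodule.span E (Set.range M.row)).subtype hv
  exact hv'.fintype_card_le_finrank

/-! ### Rows of the pseudorange rigidity matrix -/

/-- The row of an edge in the transposed incidence matrix, the edge being oriented from its smaller
to its larger end. -/
def incRow (e : Sym2 (Fin n)) (w : Fin n) : ℝ :=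
  (if w = e.sup then 1 else 0) - (if w = e.inf then 1 else 0)

/-- The sign of an arc with respect to the orientation of its edge from the smaller to the larger
end. -/
def arcSign (u v : Fin n) : ℝ := if u < v then 1 else -1

theorem arcSign_eq (u v : Fin n) : arcSign u v = 1 ∨ arcSign u v = -1 := by
  unfold arcSign
  split_ifs <;> simp

theorem arcSign_swap {u v : Fin n} (h : u ≠ v) : arcSign v u = -arcSign u v := by
  unfold arcSign
  rcases lt_or_gt_of_ne h with h | h
  · simp [h, h.not_gt]
  · simp [h, h.not_gt]

theorem arcSign_mul_incRow (u v w : Fin n) :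
    arcSign u v * incRow s(u, v) w = (if w = v then 1 else 0) - (if w = u then 1 else 0) := by
  unfold arcSign incRow
  rcases lt_or_ge u v with h | h
  · simp [h, h.le]
  · simp [h, h.not_gt]

theorem norm_agentPos_sub_eq_sqrt_sqDist (x : Positions n d) (u v : Fin n) :
    ‖agentPos x u - agentPos x v‖ = Real.sqrt (sqDist x s(u, v)) :=
  norm_agentPos_sub x u v

open scoped Classical in
theorem rigidityP_row (Γ : Digraph (Fin n)) (p : Config n d) (a : Arc Γ) :
    (rigidityP Γ p).row a = Sum.elim (distRow p.positions s(a.1.1, a.1.2))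
      ((arcSign a.1.1 a.1.2 * Real.sqrt (sqDist p.positions s(a.1.1, a.1.2))) •
        incRow s(a.1.1, a.1.2)) := by
  funext j
  rw [rigidityP_eq_fromCols]
  rcases j with j | j
  · rfl
  · change (distDiag Γ p.positions * (incidenceArc Γ)ᵀ) a j = _
    rw [distDiag, Matrix.diagonal_mul, norm_agentPos_sub_eq_sqrt_sqDist]
    simp only [Sum.elim_inr, Pi.smul_apply, smul_eq_mul, Matrix.transpose_apply, incidenceArc,
      Matrix.of_apply]
    rw [← arcSign_mul_incRow]
    ring

/-! ### Edges of the underlying multigraph -/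

theorem count_underlyingEdges (Γ : Digraph (Fin n)) {u v : Fin n} (h : u ≠ v) :
    (underlyingEdges Γ).count s(u, v) =
      (open scoped Classical in (if Γ.Adj u v then 1 else 0) + if Γ.Adj v u then 1 else 0) := by
  classical
  have h1 : (underlyingEdges Γ).count s(u, v) =
      ((Finset.univ : Finset (Arc Γ)).filter fun a => s(u, v) = s(a.1.1, a.1.2)).card := by
    rw [underlyingEdges, Multiset.count_map]
    rw [Finset.card_def, Finset.filter_val]
  have h2 : ((Finset.univ : Finset (Arc Γ)).filter fun a => s(u, v) = s(a.1.1, a.1.2)).card =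
      (({(u, v), (v, u)} : Finset (Fin n × Fin n)).filter fun a => Γ.Adj a.1 a.2).card := by
    refine Finset.card_bij (fun a _ => a.1) ?_ (fun a _ b _ hab => Subtype.ext hab) ?_
    · rintro ⟨⟨a, b⟩, hab⟩ hm
      simp at hm ⊢
      grind
    · rintro ⟨a, b⟩ hm
      simp at hm
      exact ⟨⟨(a, b), hm.2⟩, by simp; grind, rfl⟩
  rw [h1, h2, Finset.filter_insert, Finset.filter_singleton]
  have : (u, v) ≠ (v, u) := fun h' => h (congrArg Prod.fst h')
  split_ifs <;> simp_all

theorem mem_edgesOfMult_two_iff (Γ : Digraph (Fin n)) {u v : Fin n} (h : u ≠ v) :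
    s(u, v) ∈ edgesOfMult (underlyingEdges Γ) 2 ↔ Γ.Adj u v ∧ Γ.Adj v u := by
  classical
  rw [edgesOfMult, Set.mem_ofPred_eq, count_underlyingEdges Γ h]
  split_ifs <;> simp_all

theorem mem_edgesOfMult_one_union_two_iff (Γ : Digraph (Fin n)) {u v : Fin n} (h : u ≠ v) :
    s(u, v) ∈ edgesOfMult (underlyingEdges Γ) 1 ∪ edgesOfMult (underlyingEdges Γ) 2 ↔
      Γ.Adj u v ∨ Γ.Adj v u := by
  classical
  simp only [edgesOfMult, Set.mem_union, Set.mem_ofPred_eq, count_underlyingEdges Γ h]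
  split_ifs <;> simp_all

/-! ### Every decomposition bounds the rank from below -/

theorem exists_sign_mem_span_rigidityP (Γ : Digraph (Fin n)) (p : Config n d) {e : Sym2 (Fin n)}
    (he : ¬ e.IsDiag)
    (hmem : e ∈ edgesOfMult (underlyingEdges Γ) 1 ∪ edgesOfMult (underlyingEdges Γ) 2) :
    ∃ σ : ℝ, (σ = 1 ∨ σ = -1) ∧ Sum.elim (distRow p.positions e)
      ((σ * Real.sqrt (sqDist p.positions e)) • incRow e) ∈
        Submodule.span ℝ (Set.range (rigidityP Γ p).row) := by
  induction e with
  | _ u v =>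
    have huv : u ≠ v := by simpa using he
    rcases (mem_edgesOfMult_one_union_two_iff Γ huv).1 hmem with h | h
    · exact ⟨arcSign u v, arcSign_eq u v,
        Submodule.subset_span ⟨⟨(u, v), h⟩, rigidityP_row Γ p ⟨(u, v), h⟩⟩⟩
    · rw [Sym2.eq_swap]
      exact ⟨arcSign v u, arcSign_eq v u,
        Submodule.subset_span ⟨⟨(v, u), h⟩, rigidityP_row Γ p ⟨(v, u), h⟩⟩⟩

/-- The rows of the two opposite arcs are `(distRow, ±c • incRow)` with `c ≠ 0`; their half-sum and
scaled difference are the two vectors. -/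
theorem mem_span_rigidityP_of_mult_two (Γ : Digraph (Fin n)) (p : Config n d) {e : Sym2 (Fin n)}
    (he : ¬ e.IsDiag) (hmem : e ∈ edgesOfMult (underlyingEdges Γ) 2)
    (h0 : Real.sqrt (sqDist p.positions e) ≠ 0) :
    Sum.elim (distRow p.positions e) (0 : Fin n → ℝ) ∈
        Submodule.span ℝ (Set.range (rigidityP Γ p).row) ∧
      Sum.elim (0 : Fin n × Fin d → ℝ) (incRow e) ∈
        Submodule.span ℝ (Set.range (rigidityP Γ p).row) := by
  induction e with
  | _ u v =>
    have huv : u ≠ v := by simpa using he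
    obtain ⟨h, h'⟩ := (mem_edgesOfMult_two_iff Γ huv).1 hmem
    have h1 := Submodule.subset_span (R := ℝ)
      (show _ ∈ Set.range (rigidityP Γ p).row from ⟨⟨(u, v), h⟩, rigidityP_row Γ p ⟨(u, v), h⟩⟩)
    have h2 := Submodule.subset_span (R := ℝ)
      (show _ ∈ Set.range (rigidityP Γ p).row from ⟨⟨(v, u), h'⟩, rigidityP_row Γ p ⟨(v, u), h'⟩⟩)
    simp only [arcSign_swap huv, Sym2.eq_swap (a := v) (b := u)] at h1 h2
    have hσ : arcSign u v ≠ 0 := by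
      rcases arcSign_eq u v with h | h <;> simp [h]
    constructor
    · convert Submodule.smul_mem _ (1 / 2 : ℝ) (Submodule.add_mem _ h1 h2) using 1
      funext j
      rcases j with j | j
      · simp
        ring
      · simp
    · convert Submodule.smul_mem _
        (1 / (2 * (arcSign u v * Real.sqrt (sqDist p.positions s(u, v)))))
        (Submodule.sub_mem _ h1 h2) using 1
      funext j
      rcases j with j | j
      · simp
      · simp
        field_simp
        ring

theorem rankD_add_rankS_le_rank_rigidityP (hd : 2 ≤ d) (Γ : Digraph (Fin n)) (p : Config n d)
    (hp : p.IsGeneric) (G_D G_S : SimpleGraph (Fin n))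
    (hG : IsDecomposition (underlyingEdges Γ) G_D G_S) :
    rankD d G_D + rankS G_S ≤ (rigidityP Γ p).rank := by
  classical
  set x := p.positions
  have hx : IsGenericPositions x := hp
  obtain ⟨hunion, hinter⟩ := hG
  set E₂ := edgesOfMult (underlyingEdges Γ) 2
  set S := Submodule.span ℝ (Set.range (rigidityP Γ p).row)
  set K := Subfield.closure (Set.range x)
  let len : Sym2 (Fin n) → ℝ := fun e => Real.sqrt (sqDist x e)
  have hD : ∀ e ∈ G_D.edgeSet, ¬ e.IsDiag := fun e he => G_D.not_isDiag_of_mem_edgeSet he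
  have hS : ∀ e ∈ G_S.edgeSet, ¬ e.IsDiag := fun e he => G_S.not_isDiag_of_mem_edgeSet he
  rw [← rank_rigidityD_of_generic G_D x hx]
  obtain ⟨f, hf⟩ := exists_independent_rows (rigidityD G_D x)
  obtain ⟨g, hg⟩ := exists_independent_rows (incidence G_S)ᵀ
  have hgr : (incidence G_S)ᵀ.rank = rankS G_S := by
    rw [Matrix.rank_transpose]
    rfl
  have hfi : Function.Injective f := fun i j h => hf.injective
    (congrArg (rigidityD G_D x).row h)
  have hgi : Function.Injective g := fun i j h => hg.injective
    (congrArg (incidence G_S)ᵀ.row h)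
  let e : Fin (rigidityD G_D x).rank ⊕ Fin (incidence G_S)ᵀ.rank → Sym2 (Fin n) :=
    Sum.elim (fun i => (f i).1) (fun i => (g i).1)
  have he : ∀ i, ¬ (e i).IsDiag := by
    rintro (i | i)
    exacts [hD _ (f i).2, hS _ (g i).2]
  have heU : ∀ i, e i ∈ edgesOfMult (underlyingEdges Γ) 1 ∪ E₂ := by
    intro i
    rw [← hunion]
    rcases i with i | i
    exacts [Or.inl (f i).2, Or.inr (g i).2]
  have heinj : ∀ i j, e i = e j → e i ∉ E₂ → i = j := by
    rintro (i | i) (j | j) hij hi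
    · exact congrArg _ (hfi (Subtype.ext hij))
    · exact absurd
        (hinter ▸ ⟨(f i).2, (show (f i).1 = (g j).1 from hij) ▸ (g j).2⟩ : (f i).1 ∈ E₂) hi
    · exact absurd
        (hinter ▸ ⟨(show (g i).1 = (f j).1 from hij) ▸ (f j).2, (g i).2⟩ : (g i).1 ∈ E₂) hi
    · exact congrArg _ (hgi (Subtype.ext hij))
  choose σ hσ hσS using fun i => exists_sign_mem_span_rigidityP Γ p (he i) (heU i)
  -- The vectors `w + t • z` will lie in the row space. A double edge contributes only the part of
  -- the side it was chosen for, with `t = s`; a single edge contributes its full row, with `t = ±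
  -- len`.
  let w : Fin (rigidityD G_D x).rank ⊕ Fin (incidence G_S)ᵀ.rank →
      (Fin n × Fin d) ⊕ Fin n → ℝ :=
    fun i => if e i ∈ E₂ ∧ i.isRight then 0 else Sum.elim (distRow x (e i)) 0
  let z : Fin (rigidityD G_D x).rank ⊕ Fin (incidence G_S)ᵀ.rank →
      (Fin n × Fin d) ⊕ Fin n → ℝ :=
    fun i => if e i ∈ E₂ ∧ i.isLeft then 0 else Sum.elim 0 (incRow (e i))
  let s : Fin (rigidityD G_D x).rank ⊕ Fin (incidence G_S)ᵀ.rank → ℝ :=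
    Sum.elim (fun _ => 0) (fun _ => 1)
  let t : Fin (rigidityD G_D x).rank ⊕ Fin (incidence G_S)ᵀ.rank → ℝ :=
    fun i => if e i ∈ E₂ then s i else σ i * len (e i)
  have hite : ∀ (q : Prop) [Decidable q], (if q then 1 else 0 : ℝ) ∈ K := fun q _ => by
    split_ifs
    exacts [K.one_mem, K.zero_mem]
  have hdist : ∀ e j, distRow x e j ∈ K := fun e j => by
    induction e with
    | _ u v =>
      exact K.mul_mem (K.sub_mem (hite _) (hite _)) (K.sub_mem
        (Subfield.subset_closure ⟨_, rfl⟩) (Subfield.subset_closure ⟨_, rfl⟩))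
  have hinc : ∀ (e : Sym2 (Fin n)) (j : Fin n), incRow e j ∈ K := fun e j =>
    K.sub_mem (hite _) (hite _)
  have hw : ∀ i j, w i j ∈ K := fun i j => by
    by_cases h : e i ∈ E₂ ∧ i.isRight
    · simp [w, h, K.zero_mem]
    · rcases j with j | j <;> simp [w, h, K.zero_mem, hdist]
  have hz : ∀ i j, z i j ∈ K := fun i j => by
    by_cases h : e i ∈ E₂ ∧ i.isLeft
    · simp [z, h, K.zero_mem]
    · rcases j with j | j <;> simp [z, h, K.zero_mem, hinc]
  have hs : ∀ i, s i ∈ K := by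
    rintro (i | i)
    exacts [K.zero_mem, K.one_mem]
  have h0 : LinearIndependent ℝ fun i => w i + s i • z i := by
    have hsplit : (fun i => w i + s i • z i) =
        Sum.elim (fun i => Sum.elim (distRow x (f i).1) 0)
          (fun i => Sum.elim (if (g i).1 ∈ E₂ then 0 else distRow x (g i).1)
            (incRow (g i).1)) := by
      funext i j
      rcases i with i | i
      · rcases j with j | j <;> simp [w, z, s, e]
      · by_cases h : (g i).1 ∈ E₂ <;> rcases j with j | j <;> simp [w, z, s, e, h]
    rw [hsplit]
    exact linearIndependent_block _ _ _ hf hg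
  have ht : ∀ (J : Finset _) (i), i ∉ J →
      t i = s i ∨ t i ∉ Subfield.closure ((K : Set ℝ) ∪ t '' J) := by
    intro J i hiJ
    by_cases hi : e i ∈ E₂
    · exact Or.inl (if_pos hi)
    right
    intro hmem
    -- Only single edges bring in a square root. They occur at most once among all indices
    -- (`heinj`), so `e i ∉ F`.
    let F : Finset (Sym2 (Fin n)) := (J.filter fun j => e j ∉ E₂).image e
    have hnot := sqrt_sqDist_notMem hx hd (he i) F (fun h => by
      obtain ⟨j, hj, hji⟩ := Finset.mem_image.1 h
      obtain ⟨hjJ, hj⟩ := Finset.mem_filter.1 hj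
      exact hiJ (heinj j i hji hj ▸ hjJ)) (fun f hf => by
      obtain ⟨j, -, rfl⟩ := Finset.mem_image.1 hf
      exact he j)
    set L := Subfield.closure ((K : Set ℝ) ∪ (fun f => Real.sqrt (sqDist x f)) '' F)
    have hle : Subfield.closure ((K : Set ℝ) ∪ t '' J) ≤ L := by
      refine Subfield.closure_le.2 ?_
      rintro y (hy | ⟨j, hj, rfl⟩)
      · exact Subfield.subset_closure (Or.inl hy)
      · by_cases hjE : e j ∈ E₂
        · simp only [t, if_pos hjE]
          exact Subfield.subset_closure (Or.inl (hs j))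
        · have hl : len (e j) ∈ L := Subfield.subset_closure (Or.inr ⟨e j, Finset.mem_coe.2
            (Finset.mem_image_of_mem e (Finset.mem_filter.2 ⟨hj, hjE⟩)), rfl⟩)
          rcases hσ j with h | h
          · simpa [t, hjE, h] using hl
          · simpa [t, hjE, h] using hl
    refine hnot ?_
    have := hle hmem
    rcases hσ i with h | h
    · simpa [t, hi, h, len] using this
    · simpa [t, hi, h, len] using this
  have hli := linearIndependent_add_smul K w z s t hw hz hs ht h0
  have hmem : ∀ i, w i + t i • z i ∈ S := by
    intro i
    by_cases hi : e i ∈ E₂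
    · have h2 := mem_span_rigidityP_of_mult_two Γ p (he i) hi
        (Real.sqrt_pos.2 (sqDist_pos hx (by lia) (he i))).ne'
      rcases i with i | i
      · simpa [w, z, t, s, hi] using h2.1
      · simpa [w, z, t, s, hi] using h2.2
    · convert hσS i using 1
      funext j
      rcases j with j | j <;> simp [w, z, t, hi, len, x]
  have hcard := card_le_rank_of_mem_span (rigidityP Γ p) hli hmem
  rwa [Fintype.card_sum, Fintype.card_fin, Fintype.card_fin, hgr] at hcard

/-! ### Some decomposition attains the rank -/

theorem exists_det_piecewise_ne_zero {E ι : Type*} [Field E] [Fintype ι] [DecidableEq ι]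
    (w z : ι → ι → E) (h : (Matrix.of (w + z)).det ≠ 0) :
    ∃ s : Finset ι, (Matrix.of (s.piecewise w z)).det ≠ 0 := by
  have h1 : (Matrix.of (w + z)).det = ∑ s : Finset ι, (Matrix.of (s.piecewise w z)).det :=
    (Matrix.detRowAlternating (R := E)).map_add_univ w z
  rw [h1] at h
  obtain ⟨s, -, hs⟩ := Finset.exists_ne_zero_of_sum_ne_zero h
  exact ⟨s, hs⟩

theorem linearIndependent_of_sumElim_zero_right {E ι α β : Type*} [Field E] [Fintype ι]
    {a : ι → α → E} (h : LinearIndependent E fun i => Sum.elim (a i) (0 : β → E)) :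
    LinearIndependent E a := by
  rw [Fintype.linearIndependent_iff] at h ⊢
  intro g hg
  refine h g ?_
  funext j
  rcases j with j | j
  · simpa [Finset.sum_apply] using congrFun hg j
  · simp [Finset.sum_apply]

theorem linearIndependent_of_sumElim_zero_left {E ι α β : Type*} [Field E] [Fintype ι]
    {b : ι → β → E} (h : LinearIndependent E fun i => Sum.elim (0 : α → E) (b i)) :
    LinearIndependent E b := by
  rw [Fintype.linearIndependent_iff] at h ⊢
  intro g hg
  refine h g ?_
  funext j
  rcases j with j | j
  · simp [Finset.sum_apply]
  · simpa [Finset.sum_apply] using congrFun hg j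

theorem mem_edgesOfMult_of_arc {Γ : Digraph (Fin n)} (hΓ : ∀ v, ¬ Γ.Adj v v) (a : Arc Γ) :
    s(a.1.1, a.1.2) ∈ edgesOfMult (underlyingEdges Γ) 1 ∪ edgesOfMult (underlyingEdges Γ) 2 :=
  (mem_edgesOfMult_one_union_two_iff Γ fun h => hΓ a.1.1 (by
    have := a.2; rwa [← h] at this)).2 (Or.inl a.2)

theorem not_isDiag_of_mem_edgesOfMult {Γ : Digraph (Fin n)} (hΓ : ∀ v, ¬ Γ.Adj v v)
    {e : Sym2 (Fin n)} {k : ℕ} (hk : k ≠ 0) (he : e ∈ edgesOfMult (underlyingEdges Γ) k) :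
    ¬ e.IsDiag := by
  have hmem : e ∈ underlyingEdges Γ := by
    refine Multiset.count_ne_zero.1 ?_
    rw [show (underlyingEdges Γ).count e = k from he]
    exact hk
  obtain ⟨a, -, rfl⟩ := Multiset.mem_map.1 hmem
  intro h
  have h' : a.1.1 = a.1.2 := by simpa using h
  have := a.2
  rw [← h'] at this
  exact hΓ _ this

theorem arc_eq_of_mult_one {Γ : Digraph (Fin n)} (hΓ : ∀ v, ¬ Γ.Adj v v) {a b : Arc Γ}
    (ha : s(a.1.1, a.1.2) ∈ edgesOfMult (underlyingEdges Γ) 1)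
    (hab : s(a.1.1, a.1.2) = s(b.1.1, b.1.2)) : a = b := by
  obtain ⟨⟨u, v⟩, h⟩ := a
  obtain ⟨⟨u', v'⟩, h'⟩ := b
  simp only [Sym2.eq_iff] at hab
  rcases hab with ⟨rfl, rfl⟩ | ⟨rfl, rfl⟩
  · rfl
  · have huv : u ≠ v := fun h0 => hΓ u (by rwa [← h0] at h)
    have h2 := (mem_edgesOfMult_two_iff Γ huv).2 ⟨h, h'⟩
    have h1 : (underlyingEdges Γ).count s(u, v) = 1 := ha
    rw [edgesOfMult, Set.mem_ofPred_eq, h1] at h2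
    exact absurd h2 (by decide)

theorem card_le_rankS_of_mem_span {ι : Type*} [Fintype ι] (G : SimpleGraph (Fin n))
    {v : ι → Fin n → ℝ} (hv : LinearIndependent ℝ v)
    (h : ∀ i, v i ∈ Submodule.span ℝ (Set.range (incidence G)ᵀ.row)) :
    Fintype.card ι ≤ rankS G := by
  classical
  rw [rankS, ← Matrix.rank_transpose]
  exact card_le_rank_of_mem_span _ hv h

theorem exists_decomposition_rank_le {Γ : Digraph (Fin n)} (hΓ : ∀ v, ¬ Γ.Adj v v)
    (p : Config n d) (hp : p.IsGeneric) :
    ∃ G_D G_S : SimpleGraph (Fin n), IsDecomposition (underlyingEdges Γ) G_D G_S ∧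
      (rigidityP Γ p).rank ≤ rankD d G_D + rankS G_S := by
  classical
  set x := p.positions
  obtain ⟨f, g, hfg⟩ := exists_minor (rigidityP Γ p)
  have hf : Function.Injective f := fun i j h =>
    (linearIndependent_of_det_ne_zero (fun i => (rigidityP Γ p).row (f i)) g hfg).injective
      (congrArg (rigidityP Γ p).row h)
  let e : Fin (rigidityP Γ p).rank → Sym2 (Fin n) := fun i => s((f i).1.1, (f i).1.2)
  let c : Fin (rigidityP Γ p).rank → ℝ :=
    fun i => arcSign (f i).1.1 (f i).1.2 * Real.sqrt (sqDist x (e i))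
  let w : Fin (rigidityP Γ p).rank → (Fin n × Fin d) ⊕ Fin n → ℝ :=
    fun i => Sum.elim (distRow x (e i)) 0
  let z : Fin (rigidityP Γ p).rank → (Fin n × Fin d) ⊕ Fin n → ℝ :=
    fun i => Sum.elim 0 (c i • incRow (e i))
  have hwz : (rigidityP Γ p).submatrix f g =
      Matrix.of ((fun i j => w i (g j)) + fun i j => z i (g j)) := by
    ext i j
    have h := congrFun (rigidityP_row Γ p (f i)) (g j)
    refine h.trans ?_
    simp only [Matrix.of_apply, Pi.add_apply]
    rcases g j with k | k <;> simp [w, z, c, e, x]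
  rw [hwz] at hfg
  obtain ⟨s, hs⟩ := exists_det_piecewise_ne_zero _ _ hfg
  have hpw : (s.piecewise (fun i j => w i (g j)) fun i j => z i (g j)) =
      fun i j => s.piecewise w z i (g j) := by
    funext i j
    by_cases h : i ∈ s <;> simp [h]
  rw [hpw] at hs
  have hli := linearIndependent_of_det_ne_zero (s.piecewise w z) g hs
  have hw : LinearIndependent ℝ fun i : {i // i ∈ s} => distRow x (e i) := by
    refine linearIndependent_of_sumElim_zero_right (β := Fin n) ?_
    have h : (fun i : {i // i ∈ s} => Sum.elim (distRow x (e i)) (0 : Fin n → ℝ)) =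
        s.piecewise w z ∘ fun i : {i // i ∈ s} => i.1 := by
      funext i
      simp [w]
    rw [h]
    exact hli.comp _ Subtype.val_injective
  have hz : LinearIndependent ℝ fun i : {i // i ∉ s} => c i • incRow (e i) := by
    refine linearIndependent_of_sumElim_zero_left (α := Fin n × Fin d) ?_
    have h : (fun i : {i // i ∉ s} => Sum.elim (0 : Fin n × Fin d → ℝ) (c i • incRow (e i))) =
        s.piecewise w z ∘ fun i : {i // i ∉ s} => i.1 := by
      funext i
      simp [z, i.2]
    rw [h]
    exact hli.comp _ Subtype.val_injective
  set E₁ := edgesOfMult (underlyingEdges Γ) 1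
  set E₂ := edgesOfMult (underlyingEdges Γ) 2
  -- `Y` collects the edges whose distance part was selected. Double edges go to both graphs, single
  -- ones are divided by `Y`.
  let Y : Set (Sym2 (Fin n)) := {a | ∃ i ∈ s, e i = a}
  have hD : (SimpleGraph.fromEdgeSet (E₂ ∪ E₁ ∩ Y)).edgeSet = E₂ ∪ E₁ ∩ Y := by
    rw [SimpleGraph.edgeSet_fromEdgeSet, sdiff_eq_left]
    refine Set.disjoint_left.2 fun a ha => ?_
    rcases ha with ha | ha
    exacts [not_isDiag_of_mem_edgesOfMult hΓ two_ne_zero ha,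
      not_isDiag_of_mem_edgesOfMult hΓ one_ne_zero ha.1]
  have hS : (SimpleGraph.fromEdgeSet (E₂ ∪ E₁ ∩ Yᶜ)).edgeSet = E₂ ∪ E₁ ∩ Yᶜ := by
    rw [SimpleGraph.edgeSet_fromEdgeSet, sdiff_eq_left]
    refine Set.disjoint_left.2 fun a ha => ?_
    rcases ha with ha | ha
    exacts [not_isDiag_of_mem_edgesOfMult hΓ two_ne_zero ha,
      not_isDiag_of_mem_edgesOfMult hΓ one_ne_zero ha.1]
  refine ⟨SimpleGraph.fromEdgeSet (E₂ ∪ E₁ ∩ Y), SimpleGraph.fromEdgeSet (E₂ ∪ E₁ ∩ Yᶜ),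
    ⟨?_, ?_⟩, ?_⟩
  · rw [hD, hS]
    ext a
    simp only [Set.mem_union, Set.mem_inter_iff, Set.mem_compl_iff]
    tauto
  · rw [hD, hS]
    ext a
    simp only [Set.mem_union, Set.mem_inter_iff, Set.mem_compl_iff]
    tauto
  have h1 : Fintype.card {i // i ∈ s} ≤ rankD d (SimpleGraph.fromEdgeSet (E₂ ∪ E₁ ∩ Y)) := by
    rw [← rank_rigidityD_of_generic _ x hp]
    refine card_le_rank_of_mem_span _ hw fun i => ?_
    refine Submodule.subset_span ⟨⟨e i, ?_⟩, rfl⟩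
    rw [hD]
    rcases mem_edgesOfMult_of_arc hΓ (f i) with h | h
    exacts [Or.inr ⟨h, i.1, i.2, rfl⟩, Or.inl h]
  have h2 : Fintype.card {i // i ∉ s} ≤ rankS (SimpleGraph.fromEdgeSet (E₂ ∪ E₁ ∩ Yᶜ)) := by
    refine card_le_rankS_of_mem_span _ hz fun i => Submodule.smul_mem _ _ ?_
    refine Submodule.subset_span ⟨⟨e i, ?_⟩, rfl⟩
    rw [hS]
    rcases mem_edgesOfMult_of_arc hΓ (f i) with h | h
    · refine Or.inr ⟨h, ?_⟩
      -- A single edge comes from only one arc, so it cannot be selected for both parts.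
      rintro ⟨j, hj, hji⟩
      exact i.2 (hf (arc_eq_of_mult_one hΓ h hji.symm) ▸ hj)
    · exact Or.inl h
  have h3 := Fintype.card_subtype_compl (fun i => i ∈ s)
  have h4 := Fintype.card_subtype_le (fun i => i ∈ s)
  rw [Fintype.card_fin] at h3 h4
  lia

/-! ### The bound for arbitrary configurations -/

theorem rank_add_finrank_le_of_injective {E W m k : Type*} [Field E] [AddCommGroup W] [Module E W]
    [Fintype m] [Fintype k] [DecidableEq k] (M : Matrix m k E)
    (φ : W →ₗ[E] k → E) (hφ : Function.Injective φ) (h : ∀ c, M *ᵥ φ c = 0) :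
    M.rank + Module.finrank E W ≤ Fintype.card k := by
  have h1 := LinearMap.finrank_range_add_finrank_ker M.mulVecLin
  rw [Module.finrank_fintype_fun_eq_card] at h1
  have h2 : Module.finrank E W ≤ Module.finrank E (LinearMap.ker M.mulVecLin) :=
    LinearMap.finrank_le_finrank_of_injective (f := φ.codRestrict _ fun c => h c)
      fun a b hab => hφ (congrArg Subtype.val hab)
  rw [Matrix.rank]
  lia

theorem rank_fromCols_le {E m k l : Type*} [Field E] [Fintype m] [Fintype k] [Fintype l]
    (A : Matrix m k E) (B : Matrix m l E) : (Matrix.fromCols A B).rank ≤ A.rank + B.rank := by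
  have h : LinearMap.range (Matrix.fromCols A B).mulVecLin ≤
      LinearMap.range A.mulVecLin ⊔ LinearMap.range B.mulVecLin := by
    rintro _ ⟨v, rfl⟩
    rw [Matrix.mulVecLin_apply, Matrix.fromCols_mulVec]
    exact Submodule.add_mem_sup ⟨_, rfl⟩ ⟨_, rfl⟩
  exact (Submodule.finrank_mono h).trans (Submodule.finrank_add_le_finrank_add_finrank _ _)

-- Constant vectors lie in the kernel, and `n ≥ 1` makes them a line.
open scoped Classical in
theorem rank_incidenceArc_transpose_lt (hn : 1 ≤ n) (Γ : Digraph (Fin n)) :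
    (incidenceArc Γ)ᵀ.rank + 1 ≤ n := by
  let φ : ℝ →ₗ[ℝ] Fin n → ℝ := LinearMap.pi fun _ => LinearMap.id
  have h := rank_add_finrank_le_of_injective (incidenceArc Γ)ᵀ φ
    (fun a b hab => congrFun hab ⟨0, hn⟩) fun c => by
      funext a
      simp [Matrix.mulVec, dotProduct, incidenceArc, φ, sub_mul, Finset.sum_sub_distrib]
  simpa using h

theorem rank_rigidityDArc_le {Γ : Digraph (Fin n)} (hΓ : ∀ v, ¬ Γ.Adj v v) (x : Positions n d) :
    (rigidityDArc Γ x).rank ≤ (rigidityD (⊤ : SimpleGraph (Fin n)) x).rank := by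
  obtain ⟨f, hf⟩ := exists_independent_rows (rigidityDArc Γ x)
  have := card_le_rank_of_mem_span (rigidityD (⊤ : SimpleGraph (Fin n)) x) hf fun i => by
    refine Submodule.subset_span ⟨⟨s((f i).1.1, (f i).1.2), ?_⟩, rfl⟩
    simp only [SimpleGraph.mem_edgeSet, SimpleGraph.top_adj]
    intro h
    have h' := (f i).2
    rw [← h] at h'
    exact hΓ _ h'
  simpa using this

/-- The skew-symmetric matrix with the given entries above the diagonal, at positions `i`, `j`. -/
def skewEntry (c : Sym2 (Fin d) → ℝ) (i j : Fin d) : ℝ :=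
  ((if i < j then 1 else 0) - (if j < i then 1 else 0)) * c s(i, j)

theorem skewEntry_swap (c : Sym2 (Fin d) → ℝ) (i j : Fin d) :
    skewEntry c i j = -skewEntry c j i := by
  rw [skewEntry, skewEntry, Sym2.eq_swap]
  ring

/-- The infinitesimal rigid motions of a framework: the off-diagonal parameters describe a rotation,
the diagonal ones a translation. -/
def rigidMotion (y : Positions n d) : (Sym2 (Fin d) → ℝ) →ₗ[ℝ] Fin n × Fin d → ℝ where
  toFun c := fun j => c s(j.2, j.2) + ∑ k, skewEntry c j.2 k * y (j.1, k)
  map_add' a b := by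
    funext j
    simp only [skewEntry, Pi.add_apply, mul_add, add_mul, Finset.sum_add_distrib]
    ring
  map_smul' r a := by
    funext j
    simp only [skewEntry, Pi.smul_apply, smul_eq_mul, RingHom.id_apply, mul_add, Finset.mul_sum]
    congr 1
    exact Finset.sum_congr rfl fun k _ => by ring

theorem distRow_dotProduct (y : Positions n d) (u v : Fin n) (m : Fin n × Fin d → ℝ) :
    distRow y s(u, v) ⬝ᵥ m = ∑ i, (y (u, i) - y (v, i)) * (m (u, i) - m (v, i)) := by
  rw [dotProduct, Fintype.sum_prod_type_right]
  refine Finset.sum_congr rfl fun i _ => ?_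
  simp only [distRow, Sym2.lift_mk, sub_mul, ite_mul, one_mul, zero_mul, Finset.sum_sub_distrib,
    Finset.sum_ite_eq', Finset.mem_univ, if_true]
  ring

theorem rigidityD_mulVec_rigidMotion (G : SimpleGraph (Fin n)) (y : Positions n d)
    (c : Sym2 (Fin d) → ℝ) : rigidityD G y *ᵥ rigidMotion y c = 0 := by
  funext ⟨e, he⟩
  induction e with
  | _ u v =>
    change distRow y s(u, v) ⬝ᵥ rigidMotion y c = 0
    rw [distRow_dotProduct]
    have h1 : ∀ i, rigidMotion y c (u, i) - rigidMotion y c (v, i) =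
        ∑ k, skewEntry c i k * (y (u, k) - y (v, k)) := fun i => by
      simp [rigidMotion, mul_sub, Finset.sum_sub_distrib]
    simp only [h1, Finset.mul_sum]
    -- A skew-symmetric form vanishes on the diagonal: exchanging `i` and `k` negates the sum.
    have h2 : (∑ i, ∑ k, (y (u, i) - y (v, i)) * (skewEntry c i k * (y (u, k) - y (v, k)))) =
        -∑ i, ∑ k, (y (u, i) - y (v, i)) * (skewEntry c i k * (y (u, k) - y (v, k))) := by
      conv_lhs => rw [Finset.sum_comm]
      rw [← Finset.sum_neg_distrib]
      refine Finset.sum_congr rfl fun i _ => ?_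
      rw [← Finset.sum_neg_distrib]
      refine Finset.sum_congr rfl fun k _ => ?_
      rw [skewEntry_swap c k i]
      ring
    linarith

/-- The edge vectors from agent `0` to the agents `1, …, d`. -/
def frame {R : Type*} [CommRing R] (h : d + 1 ≤ n) (y : Fin n × Fin d → R) :
    Matrix (Fin d) (Fin d) R :=
  Matrix.of fun k j => y (Fin.castLE h k.succ, j) - y (Fin.castLE h 0, j)

theorem rigidMotion_injective (h : d + 1 ≤ n) (y : Positions n d) (hy : (frame h y).det ≠ 0) :
    Function.Injective (rigidMotion y) := by
  rw [injective_iff_map_eq_zero]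
  intro c hc
  have hmot : ∀ u i, c s(i, i) + ∑ k, skewEntry c i k * y (u, k) = 0 := fun u i =>
    congrFun hc (u, i)
  -- Subtracting the equations of two agents removes the translation; each row of the skew matrix is
  -- thus killed by the invertible frame.
  have hskew : ∀ i k, skewEntry c i k = 0 := fun i k => by
    refine congrFun (Matrix.eq_zero_of_mulVec_eq_zero hy (v := skewEntry c i) ?_) k
    funext l
    have h1 := hmot (Fin.castLE h l.succ) i
    have h2 := hmot (Fin.castLE h 0) i
    simp only [Matrix.mulVec, dotProduct, frame, Matrix.of_apply, sub_mul, Finset.sum_sub_distrib,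
      Pi.zero_apply]
    simp only [mul_comm (y _)]
    linarith
  funext a
  induction a with
  | _ i j =>
    rcases lt_trichotomy i j with hij | rfl | hij
    · simpa [skewEntry, hij, hij.not_gt] using hskew i j
    · simpa [hskew] using hmot (Fin.castLE h 0) i
    · simpa [skewEntry, hij, hij.not_gt] using hskew i j

/-- At a degenerate `x` the rigid motions need not be independent. Both a maximal minor at `x` and
the frame determinant are non-zero polynomials, so some integer point is a zero of neither. -/
theorem exists_frame_rank_rigidityD_le (h : d + 1 ≤ n) (G : SimpleGraph (Fin n))
    (x : Positions n d) : ∃ y : Positions n d, (frame h y).det ≠ 0 ∧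
      (rigidityD G x).rank ≤ (rigidityD G y).rank := by
  obtain ⟨f, g, hfg⟩ := exists_minor (rigidityD G x)
  let M : Matrix (Fin (rigidityD G x).rank) (Fin (rigidityD G x).rank)
    (MvPolynomial (Fin n × Fin d) ℤ) := Matrix.of fun a b => distRowPoly (f a).1 (g b)
  have hM : ∀ z : Positions n d,
      MvPolynomial.aeval z M.det = ((rigidityD G z).submatrix f g).det := by
    intro z
    rw [AlgHom.map_det]
    congr 1
    ext a b
    exact aeval_distRowPoly z (f a).1 (g b)
  let Q : MvPolynomial (Fin n × Fin d) ℤ := (frame h MvPolynomial.X).det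
  have hQ : ∀ z : Positions n d, MvPolynomial.aeval z Q = (frame h z).det := by
    intro z
    rw [AlgHom.map_det]
    congr 1
    ext a b
    simp [frame]
  have hM0 : M.det ≠ 0 := fun h0 => hfg <| by rw [← hM, h0, map_zero]
  have hQ0 : Q ≠ 0 := by
    intro h0
    -- Agents `1, …, d` sit at the standard basis vectors and all others at the origin, so the frame
    -- is the identity.
    let z : Positions n d := fun j => if j.1 = Fin.castLE h j.2.succ then 1 else 0
    have h1 := hQ z
    have h2 : frame h z = 1 := by
      ext a b
      have : Fin.castLE h 0 ≠ Fin.castLE h b.succ := fun h' => by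
        simp [Fin.ext_iff] at h'
      simp [frame, z, Matrix.one_apply, Fin.ext_iff]
    rw [h0, h2, map_zero, Matrix.det_one] at h1
    exact zero_ne_one h1
  obtain ⟨y, hy⟩ : ∃ y : Fin n × Fin d → ℤ, MvPolynomial.eval y (M.det * Q) ≠ 0 := by
    by_contra! hall
    exact mul_ne_zero hM0 hQ0 (MvPolynomial.funext fun y => by rw [hall y, map_zero])
  let y' : Positions n d := algebraMap ℤ ℝ ∘ y
  have hy' : MvPolynomial.aeval y' (M.det * Q) ≠ 0 := by
    rw [MvPolynomial.aeval_algebraMap_apply]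
    simpa using hy
  rw [map_mul, hM, hQ] at hy'
  exact ⟨y', right_ne_zero_of_mul hy', le_rank_of_minor _ f g (left_ne_zero_of_mul hy')⟩

theorem rank_rigidityD_le_boundD (G : SimpleGraph (Fin n)) (x : Positions n d) :
    (rigidityD G x).rank ≤ boundD n d := by
  classical
  unfold boundD
  split_ifs with h
  · obtain ⟨y, hy, hxy⟩ := exists_frame_rank_rigidityD_le h G x
    have := rank_add_finrank_le_of_injective (rigidityD G y) (rigidMotion y)
      (rigidMotion_injective h y hy) (rigidityD_mulVec_rigidMotion G y)
    -- The parameter space of rigid motions has dimension `(d + 1).choose 2`, the number of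
    -- unordered pairs with repetition.
    rw [Module.finrank_fintype_fun_eq_card, Sym2.card, Fintype.card_prod] at this
    simp only [Fintype.card_fin] at this
    lia
  · refine (Matrix.rank_le_card_height _).trans ?_
    rw [← SimpleGraph.edgeFinset_card]
    exact (SimpleGraph.card_edgeFinset_le_card_choose_two).trans (by simp)

theorem rank_rigidityP_le_boundP (hn : 1 ≤ n) {Γ : Digraph (Fin n)} (hΓ : ∀ v, ¬ Γ.Adj v v)
    (p : Config n d) : (rigidityP Γ p).rank ≤ boundP n d := by
  classical
  have h1 := rank_fromCols_le (rigidityDArc Γ p.positions)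
    (distDiag Γ p.positions * (incidenceArc Γ)ᵀ)
  have h2 := Matrix.rank_mul_le_right (distDiag Γ p.positions) (incidenceArc Γ)ᵀ
  have h3 := rank_incidenceArc_transpose_lt hn Γ
  have h4 := (rank_rigidityDArc_le hΓ p.positions).trans (rank_rigidityD_le_boundD ⊤ _)
  have h5 : (rigidityP Γ p).rank ≤ (rigidityDArc Γ p.positions).rank +
      (distDiag Γ p.positions * (incidenceArc Γ)ᵀ).rank := by
    rw [rigidityP_eq_fromCols]
    convert h1
  have h6 : (distDiag Γ p.positions * (incidenceArc Γ)ᵀ).rank ≤ (incidenceArc Γ)ᵀ.rank := by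
    convert h2
  unfold boundP
  lia

end PseudorangeRigidity

end

theorem theorem1 (n d : ℕ) (hn : 1 ≤ n) (hd : 2 ≤ d) (Γ : Digraph (Fin n))
    (hΓ : ∀ v, ¬ Γ.Adj v v) (p : PseudorangeRigidity.Config n d) :
    (p.IsGeneric →
      IsGreatest
        {r : ℕ | ∃ G_D G_S : SimpleGraph (Fin n),
          PseudorangeRigidity.IsDecomposition (PseudorangeRigidity.underlyingEdges Γ) G_D G_S ∧
            r = PseudorangeRigidity.rankD d G_D + PseudorangeRigidity.rankS G_S}
        (PseudorangeRigidity.rigidityP Γ p).rank) ∧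
      (PseudorangeRigidity.rigidityP Γ p).rank ≤ PseudorangeRigidity.boundP n d := by
  refine ⟨fun hp => ⟨?_, ?_⟩, PseudorangeRigidity.rank_rigidityP_le_boundP hn hΓ p⟩
  · obtain ⟨G_D, G_S, hG, hle⟩ := PseudorangeRigidity.exists_decomposition_rank_le hΓ p hp
    exact ⟨G_D, G_S, hG, hle.antisymm
      (PseudorangeRigidity.rankD_add_rankS_le_rank_rigidityP hd Γ p hp G_D G_S hG)⟩
  · rintro r ⟨G_D, G_S, hG, rfl⟩
    exact PseudorangeRigidity.rankD_add_rankS_le_rank_rigidityP hd Γ p hp G_D G_S hG
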